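/- \textbf{Setting.} A problem in the query model is a function $f : S \to H$ with $S \subseteq G^m$, where $G, H$ are finite alphabets; a query $i$ to the input $x \in S$ returns the character $x_i$. An \emph{adversary matrix} for $f$ is a symmetric, entrywise nonnegative real matrix $\Gamma$ indexed by $S \times S$ with $\Gamma[x,y] = 0$ whenever $f(x) = f(y)$. Let $D_i[x,y] = 1$ if $x_i \ne y_i$ and $D_i[x,y] = 0$ otherwise, let $\circ$ be the entrywise product and $\|\cdot\|$ the spectral norm. The optimal spectral adversary bound is $$SA(f) = \max_{\Gamma} \frac{\|\Gamma\|}{\max_i \|\Gamma \circ D_i\|},$$ where $\Gamma$ ranges over the nonzero adversary matrices ($SA(f) = 0$ if there are none). \textbf{Nested ordered search.} $OS_a$ is the problem with inputs $\uparrow^{k-1} * \downarrow^{a-k}$ ($1 \le k \le a$) and answer $k$. $HSOS_b$ is the problem with inputs $\rightarrow^{k-1} s \leftarrow^{b-k}$ ($1 \le k \le b$, $s \in \{\uparrow, \downarrow, *\}$) and answer $s$. $NOS_{a,b}$ is the composition $OS_a \circ (HSOS_b, \ldots, HSOS_b)$: its inputs are the concatenations $x^1 \cdots x^a$ of inputs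 of $HSOS_b$ whose string of answers $HSOS_b(x^1) \cdots HSOS_b(x^a)$ is an input of $OS_a$, and its answer is the answer of $OS_a$ on that string. \textbf{The Tarski problem.} $TARSKI(N,2)$ asks for a fixed point of a monotone function $f : [N]^2 \to [N]^2$ (coordinatewise order) which is queried at points of $[N]^2$. As a function problem it can be read in two ways: (a) the inputs are the monotone functions with exactly one fixed point, which is the answer; (b) the inputs are all monotone functions, and the answer is a fixed point selected by an arbitrary fixed rule. \textbf{Lemma.} For every integer $n \ge 2$, $$SA\bigl(TARSKI(n(n^2+n-1),\, 2)\bigr) \;\ge\; \frac17\, SA\bigl(NOS_{n+1,\,n}\bigr),$$ in reading (a), and in reading (b) for every selection rule. -/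

import Mathlib

/-! ### Problems in the query model -/

/-- A problem in the query model: the input is a string `x : ι → G` (positions `ι`, alphabet `G`)
from the domain, and the character `x i` is the response to the query `i`. -/
structure QueryProblem (ι G H : Type*) where
  /-- The set of admissible input strings. -/
  domain : Set (ι → G)
  /-- The answer to an admissible input. -/
  answer : domain → H

/-- The spectral norm of a real square matrix: its operator norm for the Euclidean norm. -/
noncomputable def spectralNorm₂ {α : Type*} [Finite α] (A : Matrix α α ℝ) : ℝ :=
  letI : Fintype α := Fintype.ofFinite α
  letI : DecidableEq α := Classical.decEq α
  ‖Matrix.toEuclideanCLM (𝕜 := ℝ) A‖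

namespace QueryProblem

/-- The distinguisher matrix of the query `i`, with entry `1` where the inputs differ at `i`. -/
noncomputable def distinguisher {ι G H : Type*} (P : QueryProblem ι G H) (i : ι) :
    Matrix P.domain P.domain ℝ :=
  open Classical in fun x y => if x.1 i = y.1 i then 0 else 1

/-- Adversary matrices: symmetric, entrywise nonnegative, and zero at every pair of inputs with
the same answer. -/
structure IsAdversary {ι G H : Type*} (P : QueryProblem ι G H)
    (Γ : Matrix P.domain P.domain ℝ) : Prop where
  symm : ∀ x y, Γ x y = Γ y x
  nonneg : ∀ x y, 0 ≤ Γ x y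
  zero_of_answer_eq : ∀ x y, P.answer x = P.answer y → Γ x y = 0

/-- The bound `‖Γ‖ / max_i ‖Γ ∘ D_i‖` given by a matrix `Γ`. The denominator is positive for every
nonzero adversary matrix; the zero matrix gets the value `0 / 0 = 0`. -/
noncomputable def adversaryRatio {ι G H : Type*} [Finite ι] [Finite G] (P : QueryProblem ι G H)
    (Γ : Matrix P.domain P.domain ℝ) : ℝ :=
  spectralNorm₂ Γ / ⨆ i : ι, spectralNorm₂ (Matrix.hadamard Γ (P.distinguisher i))

/-- The optimal spectral adversary bound. The set of values is nonempty and bounded above, see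
`zero_mem_adversaryRatios` and `bddAbove_adversaryRatios`. It is `0` for a problem all of whose
inputs have the same answer. -/
noncomputable def SA {ι G H : Type*} [Finite ι] [Finite G] (P : QueryProblem ι G H) : ℝ :=
  sSup {r : ℝ | ∃ Γ, P.IsAdversary Γ ∧ r = P.adversaryRatio Γ}

end QueryProblem

/-! The spectral adversary bound is a supremum of a nonempty bounded set. -/

theorem spectralNorm₂_nonneg {α : Type*} [Finite α] (A : Matrix α α ℝ) :
    0 ≤ spectralNorm₂ A := by
  let _ : Fintype α := Fintype.ofFinite α
  let _ : DecidableEq α := Classical.decEq α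
  exact norm_nonneg (Matrix.toEuclideanCLM (𝕜 := ℝ) A)

theorem spectralNorm₂_zero {α : Type*} [Finite α] :
    spectralNorm₂ (0 : Matrix α α ℝ) = 0 := by
  let _ : Fintype α := Fintype.ofFinite α
  let _ : DecidableEq α := Classical.decEq α
  change ‖Matrix.toEuclideanCLM (𝕜 := ℝ) (0 : Matrix α α ℝ)‖ = 0
  rw [map_zero, norm_zero]

theorem spectralNorm₂_sum_le {α κ : Type*} [Finite α] (s : Finset κ) (A : κ → Matrix α α ℝ) :
    spectralNorm₂ (∑ i ∈ s, A i) ≤ ∑ i ∈ s, spectralNorm₂ (A i) := by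
  let _ : Fintype α := Fintype.ofFinite α
  let _ : DecidableEq α := Classical.decEq α
  change ‖Matrix.toEuclideanCLM (𝕜 := ℝ) (∑ i ∈ s, A i)‖ ≤
    ∑ i ∈ s, ‖Matrix.toEuclideanCLM (𝕜 := ℝ) (A i)‖
  rw [map_sum]
  exact norm_sum_le _ _

theorem spectralNorm₂_mono {α : Type*} [Finite α] {A B : Matrix α α ℝ}
    (h0 : ∀ x y, 0 ≤ A x y) (h : ∀ x y, A x y ≤ B x y) :
    spectralNorm₂ A ≤ spectralNorm₂ B := by
  let _ : Fintype α := Fintype.ofFinite α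
  let _ : DecidableEq α := Classical.decEq α
  change ‖Matrix.toEuclideanCLM (𝕜 := ℝ) A‖ ≤ ‖Matrix.toEuclideanCLM (𝕜 := ℝ) B‖
  refine ContinuousLinearMap.opNorm_le_bound _ (norm_nonneg _) fun v => ?_
  let w : EuclideanSpace ℝ α := WithLp.toLp 2 fun i => |v i|
  have hw : ‖w‖ = ‖v‖ := by simp [w, EuclideanSpace.norm_eq]
  have key : ‖Matrix.toEuclideanCLM (𝕜 := ℝ) A v‖ ≤ ‖Matrix.toEuclideanCLM (𝕜 := ℝ) B w‖ := by
    rw [EuclideanSpace.norm_eq, EuclideanSpace.norm_eq]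
    refine Real.sqrt_le_sqrt (Finset.sum_le_sum fun i _ => ?_)
    refine pow_le_pow_left₀ (norm_nonneg _) ?_ 2
    have hA : (Matrix.toEuclideanCLM (𝕜 := ℝ) A v) i = ∑ j, A i j * v j := rfl
    have hB : (Matrix.toEuclideanCLM (𝕜 := ℝ) B w) i = ∑ j, B i j * |v j| := rfl
    rw [hA, hB, Real.norm_eq_abs, Real.norm_eq_abs]
    refine (Finset.abs_sum_le_sum_abs _ _).trans (le_trans ?_ (le_abs_self _))
    refine Finset.sum_le_sum fun j _ => ?_
    rw [abs_mul, abs_of_nonneg (h0 i j)]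
    exact mul_le_mul_of_nonneg_right (h i j) (abs_nonneg _)
  exact key.trans ((ContinuousLinearMap.le_opNorm _ _).trans_eq (by rw [hw]))

namespace QueryProblem

theorem zero_mem_adversaryRatios {ι G H : Type*} [Finite ι] [Finite G]
    (P : QueryProblem ι G H) :
    (0 : ℝ) ∈ {r : ℝ | ∃ Γ, P.IsAdversary Γ ∧ r = P.adversaryRatio Γ} :=
  ⟨0, ⟨fun _ _ => rfl, fun _ _ => le_rfl, fun _ _ _ => rfl⟩, by
    simp [adversaryRatio, spectralNorm₂_zero]⟩

theorem bddAbove_adversaryRatios {ι G H : Type*} [Finite ι] [Finite G]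
    (P : QueryProblem ι G H) :
    BddAbove {r : ℝ | ∃ Γ, P.IsAdversary Γ ∧ r = P.adversaryRatio Γ} := by
  let _ : Fintype ι := Fintype.ofFinite ι
  refine ⟨Fintype.card ι, ?_⟩
  rintro r ⟨Γ, hΓ, rfl⟩
  have hD : ∀ i x y, 0 ≤ P.distinguisher i x y := fun i x y => by
    unfold distinguisher; split_ifs <;> norm_num
  have hle : spectralNorm₂ Γ ≤
      Fintype.card ι * ⨆ i : ι, spectralNorm₂ (Matrix.hadamard Γ (P.distinguisher i)) := by
    calc spectralNorm₂ Γ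
        ≤ spectralNorm₂ (∑ i : ι, Matrix.hadamard Γ (P.distinguisher i)) := by
          refine spectralNorm₂_mono hΓ.nonneg fun x y => ?_
          rw [Matrix.sum_apply]
          by_cases hxy : x = y
          · rw [hΓ.zero_of_answer_eq x y (by rw [hxy])]
            exact Finset.sum_nonneg fun i _ => by
              simpa [Matrix.hadamard_apply] using mul_nonneg (hΓ.nonneg x y) (hD i x y)
          · obtain ⟨i, hi⟩ : ∃ i, x.1 i ≠ y.1 i := by
              by_contra! hc
              exact hxy (Subtype.ext (funext hc))
            calc Γ x y = Matrix.hadamard Γ (P.distinguisher i) x y := by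
                  simp [Matrix.hadamard_apply, distinguisher, hi]
              _ ≤ _ := Finset.single_le_sum
                  (f := fun i => Matrix.hadamard Γ (P.distinguisher i) x y)
                  (fun i _ => mul_nonneg (hΓ.nonneg x y) (hD i x y)) (Finset.mem_univ i)
      _ ≤ ∑ i : ι, spectralNorm₂ (Matrix.hadamard Γ (P.distinguisher i)) :=
          spectralNorm₂_sum_le _ _
      _ ≤ ∑ _i : ι, ⨆ i : ι, spectralNorm₂ (Matrix.hadamard Γ (P.distinguisher i)) :=
          Finset.sum_le_sum fun i _ => le_ciSup
            (f := fun i => spectralNorm₂ (Matrix.hadamard Γ (P.distinguisher i)))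
            (Set.finite_range _).bddAbove i
      _ = _ := by simp
  exact div_le_of_le_mul₀ (Real.iSup_nonneg fun i => spectralNorm₂_nonneg _)
    (Nat.cast_nonneg _) hle

/-- The composition `f ∘ (g_1, …, g_k)`: an input is the concatenation of one input `x^i` of each
inner problem `g_i`, such that the string of inner answers is an input of `f`. -/
def comp {κ : Type*} {ι : κ → Type*} {Φ Λ Ψ : Type*} (f : QueryProblem κ Λ Ψ)
    (g : (i : κ) → QueryProblem (ι i) Φ Λ) : QueryProblem (Σ i, ι i) Φ Ψ where
  domain := {x | ∃ hx : ∀ i, (fun j => x ⟨i, j⟩) ∈ (g i).domain,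
    (fun i => (g i).answer ⟨fun j => x ⟨i, j⟩, hx i⟩) ∈ f.domain}
  answer x := f.answer ⟨fun i => (g i).answer ⟨fun j => x.1 ⟨i, j⟩, x.2.1 i⟩, x.2.2⟩

end QueryProblem

/-! ### Ordered search -/

/-- The alphabet `{↑, *, ↓}`. -/
inductive OSSymbol
  | up | star | down
  deriving DecidableEq

instance : Fintype OSSymbol := ⟨{.up, .star, .down}, by rintro ⟨⟩ <;> simp⟩

/-- The alphabet `{→, ←, ↑, *, ↓}`. -/
inductive HSSymbol
  | right | left | hidden (s : OSSymbol)
  deriving DecidableEq, Fintype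

/-- The string `↑ ⋯ ↑ * ↓ ⋯ ↓` of length `m` with `*` at position `k`. -/
def osString (m : ℕ) (k : Fin m) : Fin m → OSSymbol := fun j =>
  if j < k then .up else if j = k then .star else .down

/-- The string `→ ⋯ → s ← ⋯ ←` of length `m` with `s` at position `k`. -/
def hsosString (m : ℕ) (k : Fin m) (s : OSSymbol) : Fin m → HSSymbol := fun j =>
  if j < k then .right else if j = k then .hidden s else .left

/-- Ordered search on `m` elements: return the position of `*`. -/
noncomputable def orderedSearch (m : ℕ) : QueryProblem (Fin m) OSSymbol (Fin m) where
  domain := {x | ∃ k, x = osString m k}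
  answer x := x.2.choose

/-- Hidden-symbol ordered search on `m` elements: return the hidden symbol. -/
noncomputable def hiddenSymbolOrderedSearch (m : ℕ) :
    QueryProblem (Fin m) HSSymbol OSSymbol where
  domain := {x | ∃ s k, x = hsosString m k s}
  answer x := x.2.choose

/-! The answers of the two search problems do not depend on a choice. -/

theorem orderedSearch_answer (m : ℕ) (k : Fin m) :
    (orderedSearch m).answer ⟨osString m k, k, rfl⟩ = k := by
  have hx : ∃ k', osString m k = osString m k' := ⟨k, rfl⟩
  change hx.choose = k
  have h := congrFun hx.choose_spec k
  by_contra hne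
  rcases lt_or_gt_of_ne hne with hlt | hlt
  · simp [osString, not_lt.2 hlt.le, Ne.symm hne] at h
  · simp [osString, hlt] at h

theorem hiddenSymbolOrderedSearch_answer (m : ℕ) (k : Fin m) (s : OSSymbol) :
    (hiddenSymbolOrderedSearch m).answer ⟨hsosString m k s, s, k, rfl⟩ = s := by
  have hx : ∃ s' k', hsosString m k s = hsosString m k' s' := ⟨s, k, rfl⟩
  change hx.choose = s
  obtain ⟨k', hk'⟩ := hx.choose_spec
  have h := congrFun hk' k
  simp only [hsosString, lt_irrefl, if_false, if_true] at h
  split_ifs at h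
  exact (HSSymbol.hidden.inj h).symm

/-- Nested ordered search: ordered search on `a` elements composed with `a` copies of
hidden-symbol ordered search on `b` elements. -/
noncomputable def nestedOrderedSearch (a b : ℕ) :
    QueryProblem (Σ _ : Fin a, Fin b) HSSymbol (Fin a) :=
  (orderedSearch a).comp fun _ => hiddenSymbolOrderedSearch b

/-! ### The Tarski problem -/

/-- The `k`-dimensional grid of side length `n`, with the coordinatewise order. -/
abbrev Grid (n k : ℕ) : Type := Fin k → Fin n

/-- The Tarski problem on the monotone self-maps of the grid with exactly one fixed point. -/
noncomputable def tarskiUnique (n k : ℕ) : QueryProblem (Grid n k) (Grid n k) (Grid n k) where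
  domain := {f | Monotone f ∧ ∃! v, f v = v}
  answer f := f.2.2.choose

/-- The Tarski problem on all monotone self-maps of the grid, for a rule `F` that says which
vertex counts as the answer. -/
def tarskiAll (n k : ℕ) (F : {f : Grid n k → Grid n k // Monotone f} → Grid n k) :
    QueryProblem (Grid n k) (Grid n k) (Grid n k) where
  domain := {f | Monotone f}
  answer := F

/-! A herringbone function moves the points off a monotone lattice path, its spine, along their
antidiagonal towards the spine, and the points of the spine along it towards a single fixed point.
An input of nested ordered search with hidden positions `p 0, p 1, …` and answer `k` becomes such a
function: the displacement of the spine from the main diagonal is `p i` on the antidiagonal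
`level i`, and the fixed point is on the antidiagonal `level k`.

Between `level i` and `level (i + 1)` the displacement walks from `p i` to `p (i + 1)`, starting at
a time that encodes `p i`. On a given antidiagonal a single query to block `i` therefore tells
whether the walk is over, has not begun, or is under way, and in the last case what `p i` is. To
compare a point of displacement `d` with the spine it remains to query position `d` of the blocks
`i` and `i + 1`. If the point is on the spine, then one of these three queries has hit a hidden
symbol, which shows the direction of the fixed point. So three queries determine each value of the
herringbone function.

An adversary matrix for the search extends by zero to one for the Tarski problem with the same
norm, and entrywise the product of `Γ` with the distinguisher of a point is at most the sum of its
products with the distinguishers of the three queries. Hence the two adversary bounds differ by a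
factor of at most three. -/

/-! ### Reductions between problems in the query model -/

section SpectralNorm

open scoped Matrix Matrix.Norms.L2Operator

theorem l2_opNorm_mul_mul_le {𝕜 α β γ δ : Type*} [RCLike 𝕜] [Fintype α] [Fintype β]
    [Fintype γ] [Fintype δ] [DecidableEq β] [DecidableEq γ] [DecidableEq δ]
    {B : Matrix α β 𝕜} {C : Matrix γ δ 𝕜} (hB : ‖B‖ ≤ 1) (hC : ‖C‖ ≤ 1) (A : Matrix β γ 𝕜) :
    ‖B * A * C‖ ≤ ‖A‖ :=
  calc ‖B * A * C‖ ≤ ‖B‖ * ‖A‖ * ‖C‖ :=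
        (Matrix.l2_opNorm_mul _ _).trans (by gcongr; exact Matrix.l2_opNorm_mul _ _)
    _ ≤ 1 * ‖A‖ * 1 := by gcongr
    _ = ‖A‖ := by rw [one_mul, mul_one]

theorem l2_opNorm_mul_mul_conjTranspose {𝕜 α β : Type*} [RCLike 𝕜] [Fintype α] [Fintype β]
    [DecidableEq α] [DecidableEq β] {E : Matrix β α 𝕜} (hE : Eᴴ * E = 1) (A : Matrix α α 𝕜) :
    ‖E * A * Eᴴ‖ = ‖A‖ := by
  have hnorm : ‖E‖ ≤ 1 := by
    rw [← sq_le_one_iff₀ (norm_nonneg E), sq, ← Matrix.l2_opNorm_conjTranspose_mul_self, hE,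
      ← Matrix.diagonal_one, Matrix.l2_opNorm_diagonal]
    exact (pi_norm_const_le 1).trans norm_one.le
  have hnorm' : ‖Eᴴ‖ ≤ 1 := (Matrix.l2_opNorm_conjTranspose E).trans_le hnorm
  have hA : Eᴴ * (E * A * Eᴴ) * E = A := by
    rw [Matrix.mul_assoc E, ← Matrix.mul_assoc, hE, Matrix.one_mul, Matrix.mul_assoc, hE,
      Matrix.mul_one]
  refine (l2_opNorm_mul_mul_le hnorm hnorm' A).antisymm ?_
  conv_lhs => rw [← hA]
  exact l2_opNorm_mul_mul_le hnorm' hnorm _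

theorem spectralNorm₂_eq_norm {α : Type*} [Fintype α] [DecidableEq α] (A : Matrix α α ℝ) :
    spectralNorm₂ A = ‖A‖ := by
  rw [Matrix.cstar_norm_def, spectralNorm₂]
  congr!

theorem spectralNorm₂_eq_zero {α : Type*} [Finite α] {A : Matrix α α ℝ} :
    spectralNorm₂ A = 0 ↔ A = 0 := by
  classical
  have := Fintype.ofFinite α
  rw [spectralNorm₂_eq_norm, norm_eq_zero]

variable {α β : Type*} {e : α → β}

/-- The extension by zero of a square matrix along an injective map `e` of its index set. -/
noncomputable def extendByZero (e : α → β) (A : Matrix α α ℝ) : Matrix β β ℝ := fun a b =>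
  Function.extend (Prod.map e e) (fun p => A p.1 p.2) 0 (a, b)

theorem extendByZero_apply (he : e.Injective) (A : Matrix α α ℝ) (x y : α) :
    extendByZero e A (e x) (e y) = A x y :=
  (he.prodMap he).extend_apply _ _ (x, y)

theorem extendByZero_eq_zero (A : Matrix α α ℝ) {a b : β}
    (h : a ∉ Set.range e ∨ b ∉ Set.range e) : extendByZero e A a b = 0 := by
  refine Function.extend_apply' _ _ _ ?_
  rintro ⟨⟨x, y⟩, hxy⟩
  obtain ⟨rfl, rfl⟩ := Prod.ext_iff.1 hxy
  simp at h

theorem exists_or_notMem_range (e : α → β) (a b : β) :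
    (∃ x y, e x = a ∧ e y = b) ∨ a ∉ Set.range e ∨ b ∉ Set.range e := by
  by_cases h : a ∈ Set.range e ∧ b ∈ Set.range e
  · obtain ⟨⟨x, hx⟩, y, hy⟩ := h
    exact .inl ⟨x, y, hx, hy⟩
  · exact .inr (not_and_or.1 h)

theorem extendByZero_hadamard (he : e.Injective) (A : Matrix α α ℝ) (B : Matrix β β ℝ) :
    extendByZero e A ⊙ B = extendByZero e (A ⊙ B.submatrix e e) := by
  ext a b
  rcases exists_or_notMem_range e a b with ⟨x, y, rfl, rfl⟩ | hab
  · simp only [Matrix.hadamard_apply, extendByZero_apply he, Matrix.submatrix_apply]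
  · rw [Matrix.hadamard_apply, extendByZero_eq_zero _ hab, extendByZero_eq_zero _ hab, zero_mul]

theorem extendByZero_eq_mul [Fintype α] [DecidableEq β] (he : e.Injective) (A : Matrix α α ℝ) :
    extendByZero e A =
      (1 : Matrix β β ℝ).submatrix id e * A * ((1 : Matrix β β ℝ).submatrix id e)ᴴ := by
  classical
  ext a b
  rcases exists_or_notMem_range e a b with ⟨x, y, rfl, rfl⟩ | hab
  · simp [extendByZero_apply he, Matrix.mul_apply, Matrix.one_apply, he.eq_iff]
  · rw [extendByZero_eq_zero _ hab]
    rcases hab with ha | hb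
    · have hne : ∀ x, a ≠ e x := fun x h => ha ⟨x, h.symm⟩
      simp [Matrix.mul_apply, Matrix.one_apply, hne]
    · have hne : ∀ y, e y ≠ b := fun y h => hb ⟨y, h⟩
      simp [Matrix.mul_apply, Matrix.one_apply, hne]

theorem spectralNorm₂_extendByZero [Finite α] [Finite β] (he : e.Injective) (A : Matrix α α ℝ) :
    spectralNorm₂ (extendByZero e A) = spectralNorm₂ A := by
  classical
  have := Fintype.ofFinite α
  have := Fintype.ofFinite β
  have hisometry :
      ((1 : Matrix β β ℝ).submatrix id e)ᴴ * (1 : Matrix β β ℝ).submatrix id e = 1 := by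
    rw [Matrix.conjTranspose_submatrix, Matrix.conjTranspose_one,
      ← Matrix.submatrix_mul _ _ e id e Function.bijective_id, mul_one, Matrix.submatrix_one e he]
  rw [spectralNorm₂_eq_norm, spectralNorm₂_eq_norm, extendByZero_eq_mul he,
    l2_opNorm_mul_mul_conjTranspose hisometry]

end SpectralNorm

namespace QueryProblem

variable {ι κ G G' H H' : Type*}

theorem distinguisher_nonneg (P : QueryProblem ι G H) (i : ι) (x y : P.domain) :
    0 ≤ P.distinguisher i x y := by
  unfold distinguisher
  split_ifs <;> norm_num

theorem distinguisher_of_eq {P : QueryProblem ι G H} {i : ι} {x y : P.domain}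
    (h : x.1 i = y.1 i) : P.distinguisher i x y = 0 :=
  if_pos h

theorem distinguisher_of_ne {P : QueryProblem ι G H} {i : ι} {x y : P.domain}
    (h : x.1 i ≠ y.1 i) : P.distinguisher i x y = 1 :=
  if_neg h

theorem IsAdversary.eq_zero {P : QueryProblem ι G H} {Γ : Matrix P.domain P.domain ℝ}
    (hΓ : P.IsAdversary Γ) (h : ∀ i, Matrix.hadamard Γ (P.distinguisher i) = 0) : Γ = 0 := by
  ext x y
  by_cases hxy : x = y
  · exact hΓ.zero_of_answer_eq x y (congrArg _ hxy)
  · obtain ⟨i, hi⟩ := Function.ne_iff.1 (Subtype.coe_ne_coe.2 hxy)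
    have := congrFun₂ (h i) x y
    rwa [Matrix.hadamard_apply, distinguisher_of_ne hi, mul_one] at this

section FiniteStrings

variable [Finite ι] [Finite G]

/-- The largest norm `max_i ‖Γ ∘ D_i‖`, the denominator of the adversary ratio. -/
noncomputable def queryNorm (P : QueryProblem ι G H) (Γ : Matrix P.domain P.domain ℝ) : ℝ :=
  ⨆ i : ι, spectralNorm₂ (Matrix.hadamard Γ (P.distinguisher i))

theorem spectralNorm₂_hadamard_le_queryNorm (P : QueryProblem ι G H)
    (Γ : Matrix P.domain P.domain ℝ) (i : ι) :
    spectralNorm₂ (Matrix.hadamard Γ (P.distinguisher i)) ≤ P.queryNorm Γ :=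
  le_ciSup (f := fun i => spectralNorm₂ (Matrix.hadamard Γ (P.distinguisher i)))
    (Set.finite_range _).bddAbove i

theorem queryNorm_nonneg (P : QueryProblem ι G H) (Γ : Matrix P.domain P.domain ℝ) :
    0 ≤ P.queryNorm Γ :=
  Real.iSup_nonneg fun _ => spectralNorm₂_nonneg _

theorem IsAdversary.eq_zero_of_queryNorm_eq_zero {P : QueryProblem ι G H}
    {Γ : Matrix P.domain P.domain ℝ} (hΓ : P.IsAdversary Γ) (h : P.queryNorm Γ = 0) : Γ = 0 :=
  hΓ.eq_zero fun i => spectralNorm₂_eq_zero.1 <|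
    ((P.spectralNorm₂_hadamard_le_queryNorm Γ i).trans_eq h).antisymm (spectralNorm₂_nonneg _)

theorem SA_nonneg (P : QueryProblem ι G H) : 0 ≤ P.SA :=
  le_csSup P.bddAbove_adversaryRatios P.zero_mem_adversaryRatios

theorem IsAdversary.spectralNorm₂_le {P : QueryProblem ι G H} {Γ : Matrix P.domain P.domain ℝ}
    (hΓ : P.IsAdversary Γ) : spectralNorm₂ Γ ≤ P.SA * P.queryNorm Γ := by
  rcases (P.queryNorm_nonneg Γ).eq_or_lt with h | h
  · rw [hΓ.eq_zero_of_queryNorm_eq_zero h.symm, spectralNorm₂_zero]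
    exact mul_nonneg P.SA_nonneg (P.queryNorm_nonneg _)
  · exact (div_le_iff₀ h).1 (le_csSup P.bddAbove_adversaryRatios ⟨Γ, hΓ, rfl⟩)

theorem SA_le_of_spectralNorm₂_le {P : QueryProblem ι G H} {r : ℝ} (hr : 0 ≤ r)
    (h : ∀ Γ, P.IsAdversary Γ → spectralNorm₂ Γ ≤ r * P.queryNorm Γ) : P.SA ≤ r := by
  refine csSup_le ⟨0, P.zero_mem_adversaryRatios⟩ ?_
  rintro _ ⟨Γ, hΓ, rfl⟩
  exact div_le_of_le_mul₀ (P.queryNorm_nonneg Γ) hr (h Γ hΓ)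

end FiniteStrings

/-- A reduction of the problem `P` to the problem `Q`: an injective map of inputs that separates
the inputs with different answers and for which every response of the image is determined by at
most `c` responses of the given input. -/
structure IsReduction (P : QueryProblem ι G H) (Q : QueryProblem κ G' H') (c : ℕ)
    (e : P.domain → Q.domain) : Prop where
  injective : e.Injective
  answer_ne : ∀ x y, P.answer x ≠ P.answer y → Q.answer (e x) ≠ Q.answer (e y)
  exists_queries : ∀ v, ∃ s : Finset ι, s.card ≤ c ∧
    ∀ x y : P.domain, (∀ i ∈ s, x.1 i = y.1 i) → (e x).1 v = (e y).1 v

namespace IsReduction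

variable {P : QueryProblem ι G H} {Q : QueryProblem κ G' H'} {c : ℕ} {e : P.domain → Q.domain}
  {Γ : Matrix P.domain P.domain ℝ}

theorem isAdversary_extendByZero (he : IsReduction P Q c e) (hΓ : P.IsAdversary Γ) :
    Q.IsAdversary (extendByZero e Γ) where
  symm a b := by
    rcases exists_or_notMem_range e a b with ⟨x, y, rfl, rfl⟩ | hab
    · rw [extendByZero_apply he.injective, extendByZero_apply he.injective, hΓ.symm]
    · rw [extendByZero_eq_zero Γ hab, extendByZero_eq_zero Γ hab.symm]
  nonneg a b := by
    rcases exists_or_notMem_range e a b with ⟨x, y, rfl, rfl⟩ | hab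
    · rw [extendByZero_apply he.injective]
      exact hΓ.nonneg x y
    · rw [extendByZero_eq_zero Γ hab]
  zero_of_answer_eq a b h := by
    rcases exists_or_notMem_range e a b with ⟨x, y, rfl, rfl⟩ | hab
    · rw [extendByZero_apply he.injective]
      exact hΓ.zero_of_answer_eq x y (not_imp_not.1 (he.answer_ne x y) h)
    · exact extendByZero_eq_zero Γ hab

theorem distinguisher_le_sum {v : κ} {s : Finset ι} {x y : P.domain}
    (hs : (∀ i ∈ s, x.1 i = y.1 i) → (e x).1 v = (e y).1 v) :
    Q.distinguisher v (e x) (e y) ≤ ∑ i ∈ s, P.distinguisher i x y := by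
  have hnonneg : ∀ i ∈ s, 0 ≤ P.distinguisher i x y := fun i _ => P.distinguisher_nonneg i x y
  by_cases hv : (e x).1 v = (e y).1 v
  · rw [distinguisher_of_eq hv]
    exact Finset.sum_nonneg hnonneg
  · obtain ⟨i, his, hi⟩ : ∃ i ∈ s, x.1 i ≠ y.1 i := by
      by_contra! hc
      exact hv (hs hc)
    rw [distinguisher_of_ne hv, ← distinguisher_of_ne hi]
    exact Finset.single_le_sum hnonneg his

variable [Finite ι] [Finite G] [Finite κ] [Finite G']

theorem queryNorm_extendByZero_le (he : IsReduction P Q c e) (hΓ : P.IsAdversary Γ) :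
    Q.queryNorm (extendByZero e Γ) ≤ c * P.queryNorm Γ := by
  have hnonneg := P.queryNorm_nonneg Γ
  refine Real.iSup_le (fun v => ?_) (by positivity)
  obtain ⟨s, hcard, hs⟩ := he.exists_queries v
  rw [extendByZero_hadamard he.injective, spectralNorm₂_extendByZero he.injective]
  calc spectralNorm₂ (Matrix.hadamard Γ ((Q.distinguisher v).submatrix e e))
      ≤ spectralNorm₂ (∑ i ∈ s, Matrix.hadamard Γ (P.distinguisher i)) := by
        refine spectralNorm₂_mono (fun x y => ?_) fun x y => ?_
        · exact mul_nonneg (hΓ.nonneg x y) (Q.distinguisher_nonneg v _ _)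
        · simp only [Matrix.sum_apply, Matrix.hadamard_apply, ← Finset.mul_sum]
          exact mul_le_mul_of_nonneg_left (distinguisher_le_sum (hs x y)) (hΓ.nonneg x y)
    _ ≤ ∑ i ∈ s, spectralNorm₂ (Matrix.hadamard Γ (P.distinguisher i)) :=
        spectralNorm₂_sum_le _ _
    _ ≤ s.card * P.queryNorm Γ := by
        rw [← nsmul_eq_mul]
        exact Finset.sum_le_card_nsmul _ _ _ fun i _ => P.spectralNorm₂_hadamard_le_queryNorm Γ i
    _ ≤ c * P.queryNorm Γ := by gcongr

theorem SA_le (he : IsReduction P Q c e) : P.SA ≤ c * Q.SA := by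
  have hQ := Q.SA_nonneg
  refine SA_le_of_spectralNorm₂_le (by positivity) fun Γ hΓ => ?_
  calc spectralNorm₂ Γ = spectralNorm₂ (extendByZero e Γ) :=
        (spectralNorm₂_extendByZero he.injective Γ).symm
    _ ≤ Q.SA * Q.queryNorm (extendByZero e Γ) :=
        (he.isAdversary_extendByZero hΓ).spectralNorm₂_le
    _ ≤ Q.SA * (c * P.queryNorm Γ) := by gcongr; exact he.queryNorm_extendByZero_le hΓ
    _ = c * Q.SA * P.queryNorm Γ := by ring

end IsReduction

end QueryProblem

/-! ### Herringbone functions -/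

/-- A spine: a lattice path which meets the antidiagonal `x + y = s` in the point
`(u s, s - u s)` and proceeds by unit steps to the right or upwards. -/
def IsSpine (u : ℤ → ℤ) : Prop :=
  ∀ s, u s ≤ u (s + 1) ∧ u (s + 1) ≤ u s + 1

/-- The point of the spine `u` on the antidiagonal `x + y = s`. -/
def spinePoint (u : ℤ → ℤ) (s : ℤ) : ℤ × ℤ := (u s, s - u s)

theorem spinePoint_fst_add_snd (u : ℤ → ℤ) (s : ℤ) : (spinePoint u s).1 + (spinePoint u s).2 = s :=
  add_sub_cancel ..

theorem spinePoint_injective (u : ℤ → ℤ) : (spinePoint u).Injective := fun s s' h => by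
  rw [← spinePoint_fst_add_snd u s, h, spinePoint_fst_add_snd]

/-- One step of length at most one from `s` towards `t`. -/
def stepTowards (t s : ℤ) : ℤ := max (s - 1) (min t (s + 1))

theorem stepTowards_eq_self {t s : ℤ} : stepTowards t s = s ↔ s = t := by
  unfold stepTowards
  lia

/-- The herringbone map of the plane with spine `u` and fixed point `spinePoint u t`: points off
the spine move along their antidiagonal towards the spine, and points of the spine move along it
towards the fixed point. -/
def herringboneStep (u : ℤ → ℤ) (t : ℤ) (z : ℤ × ℤ) : ℤ × ℤ :=
  if z.1 < u (z.1 + z.2) then (z.1 + 1, z.2 - 1)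
  else if u (z.1 + z.2) < z.1 then (z.1 - 1, z.2 + 1)
  else spinePoint u (stepTowards t (z.1 + z.2))

theorem herringboneStep_of_lt {u : ℤ → ℤ} {t : ℤ} {z : ℤ × ℤ} (h : z.1 < u (z.1 + z.2)) :
    herringboneStep u t z = (z.1 + 1, z.2 - 1) :=
  if_pos h

theorem herringboneStep_of_gt {u : ℤ → ℤ} {t : ℤ} {z : ℤ × ℤ} (h : u (z.1 + z.2) < z.1) :
    herringboneStep u t z = (z.1 - 1, z.2 + 1) := by
  rw [herringboneStep, if_neg h.not_gt, if_pos h]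

theorem herringboneStep_spinePoint (u : ℤ → ℤ) (t s : ℤ) :
    herringboneStep u t (spinePoint u s) = spinePoint u (stepTowards t s) := by
  simp [herringboneStep, spinePoint]

namespace IsSpine

variable {u : ℤ → ℤ}

theorem monotone (hu : IsSpine u) : Monotone u :=
  monotone_int_of_le_succ fun s => (hu s).1

theorem monotone_sub (hu : IsSpine u) : Monotone fun s => s - u s :=
  monotone_int_of_le_succ fun s => by have := (hu s).2; lia

theorem monotone_spinePoint (hu : IsSpine u) : Monotone (spinePoint u) :=
  hu.monotone.prodMk hu.monotone_sub

theorem monotone_herringboneStep (hu : IsSpine u) (t : ℤ) : Monotone (herringboneStep u t) := by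
  have step_le : ∀ z z' : ℤ × ℤ, z ≤ z' → z'.1 + z'.2 = z.1 + z.2 + 1 →
      herringboneStep u t z ≤ herringboneStep u t z' := by
    intro z z' hz hlevel
    obtain ⟨s, hs⟩ : ∃ s, z.1 + z.2 = s := ⟨_, rfl⟩
    have hnext : spinePoint u (stepTowards t s) ≤ spinePoint u (stepTowards t (s + 1)) :=
      hu.monotone_spinePoint (by unfold stepTowards; lia)
    have hupper : spinePoint u (stepTowards t s) ≤ spinePoint u (s + 1) :=
      hu.monotone_spinePoint (by unfold stepTowards; lia)
    have hlower : spinePoint u s ≤ spinePoint u (stepTowards t (s + 1)) :=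
      hu.monotone_spinePoint (by unfold stepTowards; lia)
    have hunit := hu s
    simp only [herringboneStep, hlevel, hs]
    simp only [Prod.le_def, spinePoint] at *
    split_ifs <;> simp only <;> lia
  exact monotone_prod_iff.2
    ⟨fun x => monotone_int_of_le_succ fun y => step_le _ _ (by simp) (by ring),
      fun y => monotone_int_of_le_succ fun x => step_le _ _ (by simp) (by ring)⟩

end IsSpine

/-- The integer coordinates of a point of the grid, counted from `0`. -/
def gridCoords {N : ℕ} (v : Grid N 2) : ℤ × ℤ := ((v 0 : ℕ), (v 1 : ℕ))

/-- The point of the grid closest to a point of the plane. -/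
def gridClamp (N : ℕ) [NeZero N] (z : ℤ × ℤ) : Grid N 2 :=
  let clamp (x : ℤ) : Fin N := ⟨min x.toNat (N - 1), by have := NeZero.pos N; lia⟩
  ![clamp z.1, clamp z.2]

section Grid

variable {N : ℕ}

theorem gridCoords_injective : (gridCoords (N := N)).Injective := fun v w h => by
  simp only [gridCoords, Prod.mk.injEq, Nat.cast_inj, Fin.val_inj] at h
  exact List.ofFn_injective (by simp [h])

theorem monotone_gridCoords : Monotone (gridCoords (N := N)) := fun v w h => by
  simpa [gridCoords] using And.intro (h 0) (h 1)

theorem gridCoords_mem_Icc (v : Grid N 2) :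
    gridCoords v ∈ Set.Icc (0 : ℤ × ℤ) ((N : ℤ) - 1, (N : ℤ) - 1) := by
  have h0 := (v 0).isLt
  have h1 := (v 1).isLt
  simp only [gridCoords, Set.mem_Icc, Prod.le_def, Prod.fst_zero, Prod.snd_zero]
  lia

variable [NeZero N]

theorem gridCoords_gridClamp (z : ℤ × ℤ) :
    gridCoords (gridClamp N z) = (max 0 (min z.1 (N - 1)), max 0 (min z.2 (N - 1))) := by
  have := NeZero.pos N
  simp only [gridCoords, gridClamp, Matrix.cons_val_zero, Matrix.cons_val_one, Prod.mk.injEq]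
  lia

theorem gridCoords_gridClamp_of_mem {z : ℤ × ℤ}
    (hz : z ∈ Set.Icc (0 : ℤ × ℤ) ((N : ℤ) - 1, (N : ℤ) - 1)) :
    gridCoords (gridClamp N z) = z := by
  obtain ⟨⟨h1, h2⟩, h3, h4⟩ := hz
  simp only [Prod.fst_zero, Prod.snd_zero] at h1 h2 h3 h4
  rw [gridCoords_gridClamp, min_eq_left h3, min_eq_left h4, max_eq_right h1, max_eq_right h2]

theorem monotone_gridClamp : Monotone (gridClamp N) := by
  intro z z' ⟨h1, h2⟩ i
  fin_cases i <;> exact Fin.mk_le_mk.2 (by lia)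

/-- The herringbone function on the grid: the herringbone map of the plane, followed by the
projection onto the grid. -/
def herringbone (N : ℕ) [NeZero N] (u : ℤ → ℤ) (t : ℤ) (v : Grid N 2) : Grid N 2 :=
  gridClamp N (herringboneStep u t (gridCoords v))

namespace IsSpine

variable {u u' : ℤ → ℤ} {s t t' : ℤ} {v v' w : Grid N 2}

theorem monotone_herringbone (hu : IsSpine u) (t : ℤ) : Monotone (herringbone N u t) :=
  monotone_gridClamp.comp ((hu.monotone_herringboneStep t).comp monotone_gridCoords)

theorem gridCoords_herringbone (hu : IsSpine u) (hw : gridCoords w = spinePoint u t)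
    (hv : gridCoords v = spinePoint u s) :
    gridCoords (herringbone N u t v) = spinePoint u (stepTowards t s) := by
  have hmem : Set.OrdConnected (spinePoint u ⁻¹' Set.Icc 0 ((N : ℤ) - 1, (N : ℤ) - 1)) :=
    Set.OrdConnected.preimage_mono Set.ordConnected_Icc hu.monotone_spinePoint
  have hs : s ∈ spinePoint u ⁻¹' Set.Icc 0 ((N : ℤ) - 1, (N : ℤ) - 1) := by
    rw [Set.mem_preimage, ← hv]
    exact gridCoords_mem_Icc v
  have ht : t ∈ spinePoint u ⁻¹' Set.Icc 0 ((N : ℤ) - 1, (N : ℤ) - 1) := by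
    rw [Set.mem_preimage, ← hw]
    exact gridCoords_mem_Icc w
  rw [herringbone, hv, herringboneStep_spinePoint, gridCoords_gridClamp_of_mem]
  refine hmem.uIcc_subset hs ht ?_
  rw [Set.mem_uIcc, stepTowards]
  lia

theorem gridCoords_eq_spinePoint_of_herringbone_eq_self (hu : IsSpine u)
    (hw : gridCoords w = spinePoint u t) (hfix : herringbone N u t v = v) :
    gridCoords v = spinePoint u ((gridCoords v).1 + (gridCoords v).2) := by
  set s := (gridCoords v).1 + (gridCoords v).2
  have hv_mem := gridCoords_mem_Icc v
  have hw_mem := gridCoords_mem_Icc w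
  have hcoords := congrArg gridCoords hfix
  rw [herringbone, gridCoords_gridClamp] at hcoords
  simp only [hw, spinePoint, Set.mem_Icc, Prod.le_def, Prod.fst_zero, Prod.snd_zero]
    at hv_mem hw_mem
  have hmono : (u s ≤ u t ∧ s - u s ≤ t - u t) ∨ (u t ≤ u s ∧ t - u t ≤ s - u s) :=
    (le_total s t).imp (fun h => hu.monotone_spinePoint h) fun h => hu.monotone_spinePoint h
  rcases lt_trichotomy (gridCoords v).1 (u s) with hlt | heq | hgt
  · rw [herringboneStep_of_lt hlt, Prod.ext_iff] at hcoords
    lia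
  · exact Prod.ext heq (by simp only [spinePoint]; lia)
  · rw [herringboneStep_of_gt hgt, Prod.ext_iff] at hcoords
    lia

theorem herringbone_eq_self_iff (hu : IsSpine u) (hw : gridCoords w = spinePoint u t) :
    herringbone N u t v = v ↔ v = w := by
  constructor
  · intro hfix
    have hv := hu.gridCoords_eq_spinePoint_of_herringbone_eq_self hw hfix
    have hstep := hu.gridCoords_herringbone hw hv
    rw [hfix, hv, (spinePoint_injective u).eq_iff, spinePoint_fst_add_snd,
      eq_comm, stepTowards_eq_self] at hstep
    rw [hstep, ← hw] at hv
    exact gridCoords_injective hv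
  · rintro rfl
    apply gridCoords_injective
    rw [hu.gridCoords_herringbone hw hw, stepTowards_eq_self.2 rfl, hw]

theorem existsUnique_herringbone_eq_self (hu : IsSpine u) (hw : gridCoords w = spinePoint u t) :
    ∃! v, herringbone N u t v = v :=
  ⟨w, (hu.herringbone_eq_self_iff hw).2 rfl, fun _ => (hu.herringbone_eq_self_iff hw).1⟩

theorem apply_le_of_herringbone_eq (hu : IsSpine u) (hw : gridCoords w = spinePoint u t)
    (hv : gridCoords v = spinePoint u s) (hv' : gridCoords v' = spinePoint u' s)
    (h : herringbone N u t v = herringbone N u' t' v) : u' s ≤ u s := by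
  by_contra! hlt
  have hv_mem := gridCoords_mem_Icc v
  have hv_mem' := gridCoords_mem_Icc v'
  have hstep := hu.gridCoords_herringbone hw hv
  rw [h, herringbone, gridCoords_gridClamp,
    herringboneStep_of_lt (by rwa [hv, spinePoint_fst_add_snd])] at hstep
  simp only [hv, hv', spinePoint, Set.mem_Icc, Prod.le_def, Prod.mk.injEq, Prod.fst_zero,
    Prod.snd_zero] at hv_mem hv_mem' hstep
  have hlevel : stepTowards t s = s := by lia
  rw [hlevel] at hstep
  lia

end IsSpine

end Grid

/-! ### The spine of a sequence of positions -/

theorem cmp_eq_cmp_iff {α β : Type*} [LinearOrder α] [LinearOrder β] {a b : α} {c d : β} :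
    cmp a b = cmp c d ↔ (a < b ↔ c < d) ∧ (b < a ↔ d < c) := by
  refine ⟨fun h => ⟨lt_iff_lt_of_cmp_eq_cmp h, lt_iff_lt_of_cmp_eq_cmp (cmp_eq_cmp_symm.1 h)⟩, ?_⟩
  rintro ⟨h1, h2⟩
  rcases lt_trichotomy a b with h | rfl | h
  · rw [h.cmp_eq_lt, (h1.1 h).cmp_eq_lt]
  · rw [cmp_self_eq_eq, eq_comm, cmp_eq_eq_iff]
    exact (not_lt.1 (h2.not.1 (lt_irrefl _))).antisymm (not_lt.1 (h1.not.1 (lt_irrefl _)))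
  · rw [h.cmp_eq_gt, (h2.1 h).cmp_eq_gt]

/-- The position at time `r` of a walker who stays at `a` until time `0` and then moves to `b`, one
unit every two time steps. Upward moves start at even times and downward moves at odd times, which
makes `s / 2 + walk a b s` a spine. -/
def walk (a b r : ℤ) : ℤ := max (a - max r 0 / 2) (min (a + (max r 0 + 1) / 2) b)

section Walk

variable {a b b' d r r' : ℤ}

theorem walk_of_nonpos (b : ℤ) (hr : r ≤ 0) : walk a b r = a := by
  unfold walk
  lia

theorem walk_of_le (h : 2 * (b - a) ≤ r + 1) (h' : 2 * (a - b) ≤ r) : walk a b r = b := by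
  unfold walk
  lia

theorem isSpine_ediv_two_add_walk (a b : ℤ) : IsSpine fun r => r / 2 + walk a b r := fun r => by
  unfold walk
  lia

theorem cmp_walk_congr (h : cmp d b = cmp d b') : cmp d (walk a b r) = cmp d (walk a b' r) := by
  rw [cmp_eq_cmp_iff] at h ⊢
  unfold walk
  lia

theorem walk_congr (h : cmp d b = cmp d b') (hd : d = walk a b r) (hr : |r' - r| ≤ 1) :
    walk a b r' = walk a b' r' := by
  rw [cmp_eq_cmp_iff] at h
  rw [abs_le] at hr
  unfold walk at *
  omega

end Walk

/-- The position at time `σ` of a walker who moves from `a` to `b` and starts at time `2 * h * a`.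
The starting time reveals `a`: if positions are at most `h`, then between the times `2 * h * j` and
`2 * h * (j + 1)` only a walker with `a = j` is on the way. -/
def crossing (h a b σ : ℤ) : ℤ := walk a b (σ - 2 * h * a)

/-- The index of the phase of length `2 * h` to which the time `σ` belongs; the last phase, of
index `h`, does not end. -/
def phase (h σ : ℤ) : ℤ := min (σ / (2 * h)) h

section Crossing

variable {h a b a' b' d σ τ : ℤ}

theorem lt_of_phase_lt (ha : a ∈ Set.Icc 0 h) (hphase : phase h σ < a) :
    σ < 2 * h * a := by
  obtain ⟨ha0, hah⟩ := ha
  have hdiv : σ / (2 * h) < a := (min_lt_iff.1 hphase).resolve_right hah.not_gt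
  have hh : 0 < h := by
    rcases (ha0.trans hah).eq_or_lt with rfl | hh
    · rw [mul_zero, Int.ediv_zero] at hdiv
      exact absurd hah hdiv.not_ge
    · exact hh
  rw [mul_comm]
  exact (Int.ediv_lt_iff_lt_mul (by positivity)).1 hdiv

theorem le_of_lt_phase (ha : 0 ≤ a) (hphase : a < phase h σ) : 2 * h * (a + 1) ≤ σ := by
  obtain ⟨hdiv, hah⟩ := lt_min_iff.1 hphase
  have hh : 0 < h := ha.trans_lt hah
  rw [mul_comm]
  exact (Int.le_ediv_iff_mul_le (by positivity)).1 hdiv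

theorem crossing_of_phase_lt (b : ℤ) (ha : a ∈ Set.Icc 0 h) (hphase : phase h σ < a)
    (hτ : |τ - σ| ≤ 1) : crossing h a b τ = a := by
  have := lt_of_phase_lt ha hphase
  exact walk_of_nonpos b (by grind)

theorem crossing_of_lt_phase (ha : 0 ≤ a) (hb : b ∈ Set.Icc 0 h) (hphase : a < phase h σ)
    (hτ : |τ - σ| ≤ 1) : crossing h a b τ = b := by
  have := le_of_lt_phase ha hphase
  have : a < h := hphase.trans_le (min_le_right _ _)
  rw [abs_le] at hτ
  obtain ⟨hb0, hbh⟩ := hb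
  exact walk_of_le (by nlinarith) (by nlinarith)

theorem cmp_crossing_congr (ha : a ∈ Set.Icc 0 h) (ha' : a' ∈ Set.Icc 0 h)
    (hb : b ∈ Set.Icc 0 h) (hb' : b' ∈ Set.Icc 0 h)
    (hphase : cmp (phase h σ) a = cmp (phase h σ) a')
    (hda : cmp d a = cmp d a') (hdb : cmp d b = cmp d b') :
    cmp d (crossing h a b σ) = cmp d (crossing h a' b' σ) := by
  have hτ : |σ - σ| ≤ 1 := by simp
  have hlt := lt_iff_lt_of_cmp_eq_cmp hphase
  have hgt := lt_iff_lt_of_cmp_eq_cmp (cmp_eq_cmp_symm.1 hphase)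
  rcases lt_trichotomy (phase h σ) a with h1 | h1 | h1
  · rwa [crossing_of_phase_lt b ha h1 hτ, crossing_of_phase_lt b' ha' (hlt.1 h1) hτ]
  · obtain rfl : a = a' := h1.symm.trans ((eq_iff_eq_of_cmp_eq_cmp hphase).1 h1)
    exact cmp_walk_congr hdb
  · rwa [crossing_of_lt_phase ha.1 hb h1 hτ, crossing_of_lt_phase ha'.1 hb' (hgt.1 h1) hτ]

theorem crossing_congr (ha : a ∈ Set.Icc 0 h) (ha' : a' ∈ Set.Icc 0 h)
    (hb : b ∈ Set.Icc 0 h) (hb' : b' ∈ Set.Icc 0 h)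
    (hphase : cmp (phase h σ) a = cmp (phase h σ) a')
    (hda : cmp d a = cmp d a') (hdb : cmp d b = cmp d b') (hd : d = crossing h a b σ)
    (hτ : |τ - σ| ≤ 1) : crossing h a b τ = crossing h a' b' τ := by
  have hσσ : |σ - σ| ≤ 1 := by simp
  have hlt := lt_iff_lt_of_cmp_eq_cmp hphase
  have hgt := lt_iff_lt_of_cmp_eq_cmp (cmp_eq_cmp_symm.1 hphase)
  rcases lt_trichotomy (phase h σ) a with h1 | h1 | h1
  · rw [crossing_of_phase_lt b ha h1 hσσ] at hd
    rw [crossing_of_phase_lt b ha h1 hτ, crossing_of_phase_lt b' ha' (hlt.1 h1) hτ,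
      ← hd, (eq_iff_eq_of_cmp_eq_cmp hda).1 hd]
  · obtain rfl : a = a' := h1.symm.trans ((eq_iff_eq_of_cmp_eq_cmp hphase).1 h1)
    exact walk_congr hdb hd (by simpa using hτ)
  · rw [crossing_of_lt_phase ha.1 hb h1 hσσ] at hd
    rw [crossing_of_lt_phase ha.1 hb h1 hτ, crossing_of_lt_phase ha'.1 hb' (hgt.1 h1) hτ,
      ← hd, (eq_iff_eq_of_cmp_eq_cmp hdb).1 hd]

end Crossing

theorem stepTowards_congr {s t t' : ℤ} (h : cmp s t = cmp s t') :
    stepTowards t s = stepTowards t' s := by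
  rw [cmp_eq_cmp_iff] at h
  unfold stepTowards
  lia

theorem herringboneStep_congr {u u' : ℤ → ℤ} {t t' s : ℤ} {z : ℤ × ℤ} (hz : z.1 + z.2 = s)
    (hcmp : cmp z.1 (u s) = cmp z.1 (u' s))
    (hspine : z.1 = u s → spinePoint u (stepTowards t s) = spinePoint u' (stepTowards t' s)) :
    herringboneStep u t z = herringboneStep u' t' z := by
  have hlt := lt_iff_lt_of_cmp_eq_cmp hcmp
  have hgt := lt_iff_lt_of_cmp_eq_cmp (cmp_eq_cmp_symm.1 hcmp)
  subst hz
  rcases lt_trichotomy z.1 (u (z.1 + z.2)) with h | h | h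
  · rw [herringboneStep_of_lt h, herringboneStep_of_lt (hlt.1 h)]
  · simp only [herringboneStep, ← hlt, ← hgt, h.not_lt, h.not_gt, if_false, hspine h]
  · rw [herringboneStep_of_gt h, herringboneStep_of_gt (hgt.1 h)]

/-- The time between two consecutive positions of the spine: `2 * h ^ 2` until the latest start of
a crossing, `2 * h` for the longest walk, and `2` more so that the walk is over one step before the
next period and periods stay even. -/
def period (h : ℤ) : ℤ := 2 * (h ^ 2 + h + 1)

/-- The displacement from the main diagonal at time `s` of a spine that is displaced by `p i` at
time `period h * i` for every `i`. -/
def offset (h : ℤ) (p : ℤ → ℤ) (s : ℤ) : ℤ :=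
  crossing h (p (s / period h)) (p (s / period h + 1)) (s % period h)

/-- The spine that encodes the sequence of positions `p`. The delay `2 * h` keeps it inside the
quadrant of points with nonnegative coordinates when it encodes `p 0, p 1, …`. -/
def positionSpine (h : ℤ) (p : ℤ → ℤ) (s : ℤ) : ℤ := s / 2 + offset h p (s - 2 * h)

/-- The antidiagonal on which `positionSpine h p` encodes `p k`. -/
def level (h k : ℤ) : ℤ := 2 * h + period h * k

section PositionSpine

variable {h a b i k k' s σ τ : ℤ} {p p' : ℤ → ℤ}

theorem period_pos (h : ℤ) : 0 < period h := by
  unfold period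
  nlinarith [sq_nonneg h, sq_nonneg (h + 1)]

theorem crossing_of_nonpos (b : ℤ) (ha : a ∈ Set.Icc 0 h) (hτ : τ ≤ 0) :
    crossing h a b τ = a :=
  walk_of_nonpos b (by nlinarith [mul_nonneg (ha.1.trans ha.2) ha.1])

theorem crossing_of_period_le (ha : a ∈ Set.Icc 0 h) (hb : b ∈ Set.Icc 0 h)
    (hτ : period h ≤ τ + 1) : crossing h a b τ = b := by
  have hmul : h * a ≤ h ^ 2 := by rw [sq]; exact mul_le_mul_of_nonneg_left ha.2 (ha.1.trans ha.2)
  obtain ⟨ha0, hah⟩ := ha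
  obtain ⟨hb0, hbh⟩ := hb
  unfold period at hτ
  exact walk_of_le (by lia) (by lia)

theorem offset_period_mul_add (hp : ∀ i, p i ∈ Set.Icc 0 h) (i : ℤ)
    (hσ : σ ∈ Set.Icc (-1) (period h)) :
    offset h p (period h * i + σ) = crossing h (p i) (p (i + 1)) σ := by
  obtain ⟨hσ1, hσ2⟩ := hσ
  have hpos := period_pos h
  have eval : ∀ j τ, 0 ≤ τ → τ < period h →
      offset h p (period h * j + τ) = crossing h (p j) (p (j + 1)) τ := by
    intro j τ h0 h1
    rw [offset, Int.mul_add_ediv_left _ _ hpos.ne', Int.mul_add_emod_self_left,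
      Int.ediv_eq_zero_of_lt h0 h1, Int.emod_eq_of_lt h0 h1, add_zero]
  rcases hσ1.eq_or_lt with rfl | hσ1
  · have hprev := eval (i - 1) (period h - 1) (by lia) (by lia)
    rw [show period h * (i - 1) + (period h - 1) = period h * i + -1 by ring, sub_add_cancel,
      crossing_of_period_le (hp _) (hp _) (by simp)] at hprev
    rw [hprev, crossing_of_nonpos _ (hp i) (by norm_num)]
  rcases hσ2.eq_or_lt with rfl | hσ2
  · have hnext := eval (i + 1) 0 le_rfl hpos
    rw [add_zero, mul_add_one, crossing_of_nonpos _ (hp _) le_rfl] at hnext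
    rw [hnext, crossing_of_period_le (hp i) (hp _) (by simp)]
  · exact eval i σ (by lia) hσ2

theorem positionSpine_level_add (hp : ∀ i, p i ∈ Set.Icc 0 h) (i : ℤ)
    (hσ : σ ∈ Set.Icc (-1) (period h)) :
    positionSpine h p (level h i + σ) =
      (level h i + σ) / 2 + crossing h (p i) (p (i + 1)) σ := by
  rw [positionSpine, ← offset_period_mul_add hp i hσ, level]
  ring_nf

theorem exists_eq_level_add (h s : ℤ) :
    ∃ i, ∃ σ ∈ Set.Ico 0 (period h), s = level h i + σ := by
  have hpos := period_pos h
  refine ⟨(s - 2 * h) / period h, (s - 2 * h) % period h,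
    ⟨Int.emod_nonneg _ hpos.ne', Int.emod_lt_of_pos _ hpos⟩, ?_⟩
  have := Int.mul_ediv_add_emod (s - 2 * h) (period h)
  unfold level
  lia

theorem even_level (h k : ℤ) : Even (level h k) := by
  unfold level period
  exact ⟨h + (h ^ 2 + h + 1) * k, by ring⟩

theorem isSpine_positionSpine (hp : ∀ i, p i ∈ Set.Icc 0 h) : IsSpine (positionSpine h p) := by
  intro s
  obtain ⟨i, σ, ⟨hσ0, hσ1⟩, rfl⟩ := exists_eq_level_add h s
  rw [add_assoc, positionSpine_level_add hp i ⟨by lia, hσ1.le⟩,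
    positionSpine_level_add hp i ⟨by lia, by lia⟩]
  obtain ⟨l, hl⟩ := even_level h i
  have hwalk := isSpine_ediv_two_add_walk (p i) (p (i + 1)) (σ - 2 * h * p i)
  rw [hl, crossing, crossing, show σ + 1 - 2 * h * p i = σ - 2 * h * p i + 1 by ring]
  rw [mul_assoc] at hwalk ⊢
  lia

theorem spinePoint_positionSpine_level (hp : ∀ i, p i ∈ Set.Icc 0 h) (k : ℤ) :
    spinePoint (positionSpine h p) (level h k) = (level h k / 2 + p k, level h k / 2 - p k) := by
  have hpos := period_pos h
  have hk := positionSpine_level_add hp k (σ := 0) ⟨by lia, hpos.le⟩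
  rw [crossing_of_nonpos _ (hp k) le_rfl, add_zero] at hk
  have hhalf := Int.two_mul_ediv_two_of_even (even_level h k)
  rw [spinePoint, hk, Prod.mk.injEq]
  lia

theorem level_add_lt_level_iff (hσ : σ ∈ Set.Ico 0 (period h)) :
    level h i + σ < level h k ↔ i < k := by
  obtain ⟨hσ0, hσ1⟩ := hσ
  have hpos := hσ0.trans_lt hσ1
  unfold level
  constructor
  · intro hlt
    by_contra! hk
    have := mul_le_mul_of_nonneg_left hk hpos.le
    lia
  · intro hk
    have := mul_le_mul_of_nonneg_left (Int.add_one_le_of_lt hk) hpos.le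
    lia

theorem level_strictMono (h : ℤ) : StrictMono (level h) := fun i k hik => by
  simpa using (level_add_lt_level_iff (σ := 0) ⟨le_rfl, period_pos h⟩).2 hik

theorem level_lt_level_add_iff (hσ : σ ∈ Set.Ico 0 (period h)) :
    level h k < level h i + σ ↔ k < i ∨ k = i ∧ 0 < σ := by
  have hmono := level_strictMono h
  rcases lt_trichotomy k i with hki | rfl | hki
  · exact iff_of_true ((hmono hki).trans_le (le_add_of_nonneg_right hσ.1)) (.inl hki)
  · simp
  · exact iff_of_false ((level_add_lt_level_iff hσ).2 hki).not_gt (by lia)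

theorem cmp_level_congr (hσ : σ ∈ Set.Ico 0 (period h)) (hcmp : cmp i k = cmp i k') :
    cmp (level h i + σ) (level h k) = cmp (level h i + σ) (level h k') := by
  rw [cmp_eq_cmp_iff] at hcmp ⊢
  simp only [level_add_lt_level_iff hσ, level_lt_level_add_iff hσ]
  lia

theorem cmp_level_congr_of_pos (hσ : σ ∈ Set.Ioo 0 (period h))
    (hcmp : cmp (i + 1) k = cmp (i + 1) k') :
    cmp (level h i + σ) (level h k) = cmp (level h i + σ) (level h k') := by
  have hσ' := Set.Ioo_subset_Ico_self hσ
  have hσ0 := hσ.1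
  rw [cmp_eq_cmp_iff] at hcmp ⊢
  simp only [level_add_lt_level_iff hσ', level_lt_level_add_iff hσ']
  lia

end PositionSpine

/-- Two inputs of nested ordered search, with positions `p`, `p'` and answers `k`, `k'`, give the
same response to the query `j` of the block `i`: it shows on which side of `j` the hidden symbol is
and, if it is at `j`, on which side of `i` the answer is. -/
def SameResponse (p p' : ℤ → ℤ) (k k' i j : ℤ) : Prop :=
  cmp j (p i) = cmp j (p' i) ∧ (j = p i → cmp i k = cmp i k')

section SameResponse

variable {h a b d i k k' σ : ℤ} {p p' : ℤ → ℤ} {z : ℤ × ℤ}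

theorem cmp_level_congr_of_eq_crossing (ha : a ∈ Set.Icc 0 h) (hb : b ∈ Set.Icc 0 h)
    (hσ : σ ∈ Set.Ico 0 (period h)) (hd : d = crossing h a b σ)
    (hphase : phase h σ = a → cmp i k = cmp i k') (hda : d = a → cmp i k = cmp i k')
    (hdb : d = b → cmp (i + 1) k = cmp (i + 1) k') :
    cmp (level h i + σ) (level h k) = cmp (level h i + σ) (level h k') := by
  have hσσ : |σ - σ| ≤ 1 := by simp
  rcases lt_trichotomy (phase h σ) a with hlt | heq | hgt
  · rw [crossing_of_phase_lt b ha hlt hσσ] at hd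
    exact cmp_level_congr hσ (hda hd)
  · exact cmp_level_congr hσ (hphase heq)
  · rw [crossing_of_lt_phase ha.1 hb hgt hσσ] at hd
    have hσ_pos : 0 < σ := by
      have := le_of_lt_phase ha.1 hgt
      have : a < h := hgt.trans_le (min_le_right _ _)
      nlinarith [ha.1]
    exact cmp_level_congr_of_pos ⟨hσ_pos, hσ.2⟩ (hdb hd)

theorem herringboneStep_positionSpine_congr (hp : ∀ i, p i ∈ Set.Icc 0 h)
    (hp' : ∀ i, p' i ∈ Set.Icc 0 h) (hσ : σ ∈ Set.Ico 0 (period h))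
    (hz : z.1 + z.2 = level h i + σ) (hphase : SameResponse p p' k k' i (phase h σ))
    (hi : SameResponse p p' k k' i (z.1 - (level h i + σ) / 2))
    (hi_succ : SameResponse p p' k k' (i + 1) (z.1 - (level h i + σ) / 2)) :
    herringboneStep (positionSpine h p) (level h k) z =
      herringboneStep (positionSpine h p') (level h k') z := by
  set d := z.1 - (level h i + σ) / 2
  have hσ_mem : σ ∈ Set.Icc (-1) (period h) := by grind
  have hcmp := cmp_crossing_congr (hp i) (hp' i) (hp (i + 1)) (hp' (i + 1)) hphase.1 hi.1 hi_succ.1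
  refine herringboneStep_congr hz ?_ fun hon_spine => ?_
  · rw [positionSpine_level_add hp i hσ_mem, positionSpine_level_add hp' i hσ_mem]
    rw [cmp_eq_cmp_iff] at hcmp ⊢
    lia
  have hd : d = crossing h (p i) (p (i + 1)) σ := by
    rw [positionSpine_level_add hp i hσ_mem] at hon_spine
    lia
  rw [← stepTowards_congr (cmp_level_congr_of_eq_crossing (hp i) (hp (i + 1)) hσ hd
    hphase.2 hi.2 hi_succ.2)]
  obtain ⟨τ, hτσ, hτ⟩ : ∃ τ, |τ - σ| ≤ 1 ∧
      stepTowards (level h k) (level h i + σ) = level h i + τ :=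
    ⟨stepTowards (level h k) (level h i + σ) - level h i, by
      rw [abs_le]; unfold stepTowards; lia, by ring⟩
  have hτ_mem : τ ∈ Set.Icc (-1) (period h) := by grind
  rw [hτ, spinePoint, spinePoint, positionSpine_level_add hp i hτ_mem,
    positionSpine_level_add hp' i hτ_mem, crossing_congr (hp i) (hp' i) (hp (i + 1)) (hp' (i + 1))
      hphase.1 hi.1 hi_succ.1 hd hτσ]

end SameResponse

/-! ### Nested ordered search -/

section NestedOrderedSearch

variable {a b h : ℕ}

theorem exists_fin_cast_eq {i : ℤ} (hi : i ∈ Set.Ico 0 (a : ℤ)) :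
    ∃ k : Fin a, ((k : ℕ) : ℤ) = i :=
  ⟨⟨i.toNat, by grind⟩, Int.toNat_of_nonneg hi.1⟩

theorem exists_eq_hsosString_osString (x : (nestedOrderedSearch a b).domain) :
    ∃ p : Fin a → Fin b, ∀ i j, x.1 ⟨i, j⟩ =
      hsosString b (p i) (osString a ((nestedOrderedSearch a b).answer x) i) j := by
  obtain ⟨x, hx, k, hk⟩ := x
  have hanswer : (nestedOrderedSearch a b).answer ⟨x, hx, k, hk⟩ = k :=
    (congrArg (orderedSearch a).answer (Subtype.ext hk)).trans (orderedSearch_answer a k)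
  choose s p hp using fun i => hx i
  refine ⟨p, fun i j => ?_⟩
  have hsymbol : osString a k i = s i := calc
    osString a k i = (hiddenSymbolOrderedSearch b).answer ⟨fun j => x ⟨i, j⟩, hx i⟩ :=
      (congrFun hk i).symm
    _ = s i := (congrArg (hiddenSymbolOrderedSearch b).answer (Subtype.ext (hp i))).trans
      (hiddenSymbolOrderedSearch_answer b (p i) (s i))
  rw [hanswer, hsymbol, ← hp i]

/-- The positions of the hidden symbols of an input of nested ordered search, extended by `0` to
the integers that do not number a block. -/
noncomputable def hiddenPosition (x : (nestedOrderedSearch a b).domain) (i : ℤ) : ℤ :=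
  if hi : i ∈ Set.Ico 0 (a : ℤ) then
    ((exists_eq_hsosString_osString x).choose (exists_fin_cast_eq hi).choose : ℕ)
  else 0

/-- The answer to an input of nested ordered search as an integer. -/
noncomputable def starPosition (x : (nestedOrderedSearch a b).domain) : ℤ :=
  ((nestedOrderedSearch a b).answer x : ℕ)

theorem exists_eq_hiddenPosition (x : (nestedOrderedSearch a b).domain) (i : Fin a) :
    ∃ p : Fin b, hiddenPosition x (i : ℕ) = (p : ℕ) ∧ ∀ j, x.1 ⟨i, j⟩ =
      hsosString b p (osString a ((nestedOrderedSearch a b).answer x) i) j := by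
  refine ⟨_, ?_, (exists_eq_hsosString_osString x).choose_spec i⟩
  have hi : ((i : ℕ) : ℤ) ∈ Set.Ico 0 (a : ℤ) := ⟨Int.natCast_nonneg _, Nat.cast_lt.2 i.isLt⟩
  rw [hiddenPosition, dif_pos hi,
    Fin.ext (Nat.cast_inj.1 (exists_fin_cast_eq hi).choose_spec : _ = (i : ℕ))]

theorem hiddenPosition_of_notMem (x : (nestedOrderedSearch a b).domain) {i : ℤ}
    (hi : i ∉ Set.Ico 0 (a : ℤ)) : hiddenPosition x i = 0 :=
  dif_neg hi

theorem hiddenPosition_mem_Icc (x : (nestedOrderedSearch a (h + 1)).domain) (i : ℤ) :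
    hiddenPosition x i ∈ Set.Icc 0 (h : ℤ) := by
  by_cases hi : i ∈ Set.Ico 0 (a : ℤ)
  · obtain ⟨i, rfl⟩ := exists_fin_cast_eq hi
    obtain ⟨p, hp, -⟩ := exists_eq_hiddenPosition x i
    grind
  · simp [hiddenPosition_of_notMem x hi]

theorem starPosition_mem_Ico (x : (nestedOrderedSearch a b).domain) :
    starPosition x ∈ Set.Ico 0 (a : ℤ) :=
  ⟨Int.natCast_nonneg _, Nat.cast_lt.2 (Fin.isLt _)⟩

theorem starPosition_inj {x y : (nestedOrderedSearch a b).domain} :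
    starPosition x = starPosition y ↔
      (nestedOrderedSearch a b).answer x = (nestedOrderedSearch a b).answer y := by
  rw [starPosition, starPosition, Nat.cast_inj, Fin.val_inj]

theorem ext_hiddenPosition {x y : (nestedOrderedSearch a b).domain}
    (hposition : ∀ i ∈ Set.Ico 0 (a : ℤ), hiddenPosition x i = hiddenPosition y i)
    (hstar : starPosition x = starPosition y) : x = y := by
  refine Subtype.ext (funext fun ⟨i, j⟩ => ?_)
  obtain ⟨p, hp, hx⟩ := exists_eq_hiddenPosition x i
  obtain ⟨q, hq, hy⟩ := exists_eq_hiddenPosition y i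
  have hpq := hposition (i : ℕ) ⟨Int.natCast_nonneg _, Nat.cast_lt.2 i.isLt⟩
  rw [hp, hq, Nat.cast_inj, Fin.val_inj] at hpq
  rw [hx, hy, hpq, starPosition_inj.1 hstar]

theorem sameResponse_of_apply_eq {x y : (nestedOrderedSearch a b).domain} {i : Fin a} {j : Fin b}
    (hxy : x.1 ⟨i, j⟩ = y.1 ⟨i, j⟩) :
    SameResponse (hiddenPosition x) (hiddenPosition y) (starPosition x) (starPosition y)
      (i : ℕ) (j : ℕ) := by
  obtain ⟨p, hp, hx⟩ := exists_eq_hiddenPosition x i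
  obtain ⟨q, hq, hy⟩ := exists_eq_hiddenPosition y i
  rw [hx, hy] at hxy
  simp only [SameResponse, hp, hq, starPosition, cmp_eq_cmp_iff, Nat.cast_lt, Nat.cast_inj,
    Fin.val_inj, Fin.val_fin_lt]
  simp only [hsosString, osString] at hxy
  split_ifs at hxy <;> simp only [HSSymbol.hidden.injEq, reduceCtorEq] at hxy <;> lia

theorem exists_query_sameResponse (a b : ℕ) (i j : ℤ) :
    ∃ s : Finset (Σ _ : Fin a, Fin b), s.card ≤ 1 ∧
      ∀ x y : (nestedOrderedSearch a b).domain, (∀ q ∈ s, x.1 q = y.1 q) →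
        SameResponse (hiddenPosition x) (hiddenPosition y) (starPosition x) (starPosition y)
          i j := by
  by_cases hi : i ∈ Set.Ico 0 (a : ℤ)
  swap
  · refine ⟨∅, by simp, fun x y _ => ⟨?_, fun _ => ?_⟩⟩
    · rw [hiddenPosition_of_notMem x hi, hiddenPosition_of_notMem y hi]
    · have hx := starPosition_mem_Ico x
      have hy := starPosition_mem_Ico y
      rw [cmp_eq_cmp_iff]
      grind
  obtain ⟨i, rfl⟩ := exists_fin_cast_eq hi
  by_cases hj : j ∈ Set.Ico 0 (b : ℤ)
  · obtain ⟨j, rfl⟩ := exists_fin_cast_eq hj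
    exact ⟨{⟨i, j⟩}, by simp, fun x y hxy => sameResponse_of_apply_eq (hxy _ (by simp))⟩
  · refine ⟨∅, by simp, fun x y _ => ?_⟩
    obtain ⟨p, hp, -⟩ := exists_eq_hiddenPosition x i
    obtain ⟨q, hq, -⟩ := exists_eq_hiddenPosition y i
    rw [SameResponse, hp, hq, cmp_eq_cmp_iff]
    grind

end NestedOrderedSearch

theorem exists_gridCoords_eq_spinePoint_level {h m N : ℕ} (hN : m * (h ^ 2 + h + 1) + 2 * h < N)
    {p : ℤ → ℤ} (hp : ∀ i, p i ∈ Set.Icc 0 (h : ℤ)) {k : ℤ} (hk : k ∈ Set.Ico 0 ((m + 1 : ℕ) : ℤ)) :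
    ∃ w : Grid N 2, gridCoords w = spinePoint (positionSpine h p) (level h k) := by
  have : NeZero N := ⟨by lia⟩
  refine ⟨_, gridCoords_gridClamp_of_mem ?_⟩
  obtain ⟨hk0, hkm⟩ := hk
  obtain ⟨hp0, hph⟩ := hp k
  have hlevel : level h k / 2 = h + k * (h ^ 2 + h + 1) := by
    unfold level period
    lia
  have hlower : 0 ≤ k * ((h : ℤ) ^ 2 + h + 1) := by positivity
  have hupper : k * ((h : ℤ) ^ 2 + h + 1) ≤ m * (h ^ 2 + h + 1) :=
    mul_le_mul_of_nonneg_right (by lia) (by positivity)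
  zify at hN
  rw [spinePoint_positionSpine_level hp, hlevel, Set.mem_Icc, Prod.mk_le_mk, Prod.zero_eq_mk,
    Prod.mk_le_mk]
  lia

/-- The Tarski instance that encodes an input of nested ordered search: the spine is given by the
positions of the hidden symbols and the fixed point by the answer. -/
noncomputable def searchHerringbone {h m : ℕ} (N : ℕ) [NeZero N]
    (x : (nestedOrderedSearch (m + 1) (h + 1)).domain) : Grid N 2 → Grid N 2 :=
  herringbone N (positionSpine h (hiddenPosition x)) (level h (starPosition x))

section SearchHerringbone

variable {h m N : ℕ} [NeZero N] {x y : (nestedOrderedSearch (m + 1) (h + 1)).domain}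

theorem monotone_searchHerringbone (x : (nestedOrderedSearch (m + 1) (h + 1)).domain) :
    Monotone (searchHerringbone N x) :=
  (isSpine_positionSpine (hiddenPosition_mem_Icc x)).monotone_herringbone _

theorem existsUnique_searchHerringbone_eq_self (hN : m * (h ^ 2 + h + 1) + 2 * h < N)
    (x : (nestedOrderedSearch (m + 1) (h + 1)).domain) :
    ∃! v, searchHerringbone N x v = v := by
  have hp := hiddenPosition_mem_Icc x
  obtain ⟨w, hw⟩ := exists_gridCoords_eq_spinePoint_level hN hp (starPosition_mem_Ico x)
  exact (isSpine_positionSpine hp).existsUnique_herringbone_eq_self hw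

theorem fst_add_snd_of_searchHerringbone_eq_self (hN : m * (h ^ 2 + h + 1) + 2 * h < N)
    {v : Grid N 2} (hv : searchHerringbone N x v = v) :
    (gridCoords v).1 + (gridCoords v).2 = level h (starPosition x) := by
  have hp := hiddenPosition_mem_Icc x
  obtain ⟨w, hw⟩ := exists_gridCoords_eq_spinePoint_level hN hp (starPosition_mem_Ico x)
  rw [((isSpine_positionSpine hp).herringbone_eq_self_iff hw).1 hv, hw, spinePoint_fst_add_snd]

theorem answer_eq_of_searchHerringbone_eq_self (hN : m * (h ^ 2 + h + 1) + 2 * h < N)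
    {v : Grid N 2} (hx : searchHerringbone N x v = v) (hy : searchHerringbone N y v = v) :
    (nestedOrderedSearch (m + 1) (h + 1)).answer x =
      (nestedOrderedSearch (m + 1) (h + 1)).answer y := by
  rw [← starPosition_inj, ← (level_strictMono h).injective.eq_iff,
    ← fst_add_snd_of_searchHerringbone_eq_self hN hx,
    fst_add_snd_of_searchHerringbone_eq_self hN hy]

theorem hiddenPosition_le_of_searchHerringbone_eq (hN : m * (h ^ 2 + h + 1) + 2 * h < N)
    (hxy : searchHerringbone N x = searchHerringbone N y) {i : ℤ}
    (hi : i ∈ Set.Ico 0 ((m + 1 : ℕ) : ℤ)) : hiddenPosition y i ≤ hiddenPosition x i := by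
  have hx := hiddenPosition_mem_Icc x
  have hy := hiddenPosition_mem_Icc y
  obtain ⟨w, hw⟩ := exists_gridCoords_eq_spinePoint_level hN hx (starPosition_mem_Ico x)
  obtain ⟨v, hv⟩ := exists_gridCoords_eq_spinePoint_level hN hx hi
  obtain ⟨v', hv'⟩ := exists_gridCoords_eq_spinePoint_level hN hy hi
  have hle := (isSpine_positionSpine hx).apply_le_of_herringbone_eq hw hv hv' (congrFun hxy v)
  have hx_level := congrArg Prod.fst (spinePoint_positionSpine_level hx i)
  have hy_level := congrArg Prod.fst (spinePoint_positionSpine_level hy i)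
  simp only [spinePoint] at hx_level hy_level
  lia

theorem searchHerringbone_injective (hN : m * (h ^ 2 + h + 1) + 2 * h < N) :
    Function.Injective (searchHerringbone N (h := h) (m := m)) := by
  intro x y hxy
  obtain ⟨v, hv, -⟩ := existsUnique_searchHerringbone_eq_self hN x
  refine ext_hiddenPosition (fun i hi => le_antisymm ?_ ?_)
    (starPosition_inj.2 (answer_eq_of_searchHerringbone_eq_self hN hv (hxy ▸ hv)))
  · exact hiddenPosition_le_of_searchHerringbone_eq hN hxy.symm hi
  · exact hiddenPosition_le_of_searchHerringbone_eq hN hxy hi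

theorem exists_queries_searchHerringbone (m h : ℕ) (v : Grid N 2) :
    ∃ s : Finset (Σ _ : Fin (m + 1), Fin (h + 1)), s.card ≤ 3 ∧
      ∀ x y : (nestedOrderedSearch (m + 1) (h + 1)).domain, (∀ q ∈ s, x.1 q = y.1 q) →
        searchHerringbone N x v = searchHerringbone N y v := by
  classical
  obtain ⟨i, σ, hσ, hv⟩ := exists_eq_level_add h ((gridCoords v).1 + (gridCoords v).2)
  have query := exists_query_sameResponse (m + 1) (h + 1)
  obtain ⟨s₁, hs₁, h₁⟩ := query i (phase h σ)
  obtain ⟨s₂, hs₂, h₂⟩ := query i ((gridCoords v).1 - (level h i + σ) / 2)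
  obtain ⟨s₃, hs₃, h₃⟩ := query (i + 1) ((gridCoords v).1 - (level h i + σ) / 2)
  refine ⟨s₁ ∪ s₂ ∪ s₃, ?_, fun x y hxy => ?_⟩
  · have := Finset.card_union_le (s₁ ∪ s₂) s₃
    have := Finset.card_union_le s₁ s₂
    lia
  · simp only [Finset.mem_union, or_imp, forall_and] at hxy
    obtain ⟨⟨hxy₁, hxy₂⟩, hxy₃⟩ := hxy
    exact congrArg (gridClamp N) (herringboneStep_positionSpine_congr (hiddenPosition_mem_Icc x)
      (hiddenPosition_mem_Icc y) hσ hv (h₁ x y hxy₁) (h₂ x y hxy₂) (h₃ x y hxy₃))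

end SearchHerringbone

theorem mainTheorem5_general {h m N : ℕ} (hN : m * (h ^ 2 + h + 1) + 2 * h < N)
    (Q : QueryProblem (Grid N 2) (Grid N 2) (Grid N 2))
    (hdomain : {f | Monotone f ∧ ∃! v, f v = v} ⊆ Q.domain)
    (hanswer : ∀ f : Q.domain, Monotone f.1 → (∃! v, f.1 v = v) → f.1 (Q.answer f) = Q.answer f) :
    (1 / 3 : ℝ) * (nestedOrderedSearch (m + 1) (h + 1)).SA ≤ Q.SA := by
  have : NeZero N := ⟨by lia⟩
  have hunique := existsUnique_searchHerringbone_eq_self (h := h) hN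
  let e (x : (nestedOrderedSearch (m + 1) (h + 1)).domain) : Q.domain :=
    ⟨searchHerringbone N x, hdomain ⟨monotone_searchHerringbone x, hunique x⟩⟩
  have hfixed x : searchHerringbone N x (Q.answer (e x)) = Q.answer (e x) :=
    hanswer (e x) (monotone_searchHerringbone x) (hunique x)
  have hreduction : (nestedOrderedSearch (m + 1) (h + 1)).IsReduction Q 3 e :=
    { injective := fun x y hxy => searchHerringbone_injective hN (congrArg Subtype.val hxy)
      answer_ne := fun x y hxy heq =>
        hxy (answer_eq_of_searchHerringbone_eq_self hN (hfixed x) (heq ▸ hfixed y))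
      exists_queries := exists_queries_searchHerringbone m h }
  have := hreduction.SA_le
  push_cast at this
  linarith

theorem mainTheorem5 (n : ℕ) (hn : 2 ≤ n) :
    (1 / 7 : ℝ) * (nestedOrderedSearch (n + 1) n).SA
        ≤ (tarskiUnique (n * (n ^ 2 + n - 1)) 2).SA ∧
      ∀ F : {f : Grid (n * (n ^ 2 + n - 1)) 2 → Grid (n * (n ^ 2 + n - 1)) 2 // Monotone f} →
          Grid (n * (n ^ 2 + n - 1)) 2,
        (∀ f, f.1 (F f) = F f) →
        (1 / 7 : ℝ) * (nestedOrderedSearch (n + 1) n).SA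
          ≤ (tarskiAll (n * (n ^ 2 + n - 1)) 2 F).SA := by
  obtain ⟨h, rfl⟩ : ∃ h, n = h + 1 := ⟨n - 1, by lia⟩
  have hsize : (h + 1) * (h ^ 2 + h + 1) + 2 * h < (h + 1) * ((h + 1) ^ 2 + (h + 1) - 1) := by
    have hsub : (h + 1) ^ 2 + (h + 1) - 1 = h ^ 2 + 3 * h + 1 := by lia
    rw [hsub]
    nlinarith
  have hSA := (nestedOrderedSearch (h + 1 + 1) (h + 1)).SA_nonneg
  refine ⟨?_, fun F hF => ?_⟩
  · linarith [mainTheorem5_general hsize (tarskiUnique _ 2) subset_rfl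
      fun f _ _ => f.2.2.choose_spec.1]
  · linarith [mainTheorem5_general hsize (tarskiAll _ 2 F) (fun f hf => hf.1) fun f _ _ => hF f]
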